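/- **Theorem (generalized Grönwall inequality).** Let $0<\gamma<1$ and let $\theta$ be the Heaviside step function. Put $g_{-\gamma}=\frac{1}{\Gamma(1-\gamma)}\,D\big(\theta(t)t^{-\gamma}\big)$, where $D$ is the distributional derivative. For $0<T\le\infty$, $w\in L^1_{\mathrm{loc}}[0,T)$ and $w_0\in\mathbb R$, the generalized Caputo derivative of $w$ associated with the initial value $w_0$ is the distribution on $(-\infty,T)$ $$D_c^\gamma w=g_{-\gamma}*\big((w-w_0)\theta\big).$$ For distributions, $F\le G$ on an open interval $U$ means $\langle F,\varphi\rangle\le\langle G,\varphi\rangle$ for all $\varphi\in C_c^\infty(U)$ with $\varphi\ge 0$. Let $-\infty\le\alpha<\beta\le\infty$, and let $f:[0,\infty)\times(\alpha,\beta)\to\mathbb R$ be continuous and locally Lipschitz in its second variable, i.e. for every compact $K\subset[0,\infty)\times(\alpha,\beta)$ there is $L_K$ with $|f(t,x)-f(t,y)|\le L_K|x-y|$ whenever $(t,x),(t,y)\in K$. Let $0<T_u,T_v\le\infty$ and $u_0,v_0\in\mathbb R$. Let $u:[0,T_u)\to(\alpha,\beta)$ be a continuous solution of $$D_c^\gamma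 u=f(t,u)$$ with initial value $u_0$, the equality being one of distributions on $(-\infty,T_u)$, where $f(t,u(t))$ is extended by $0$ to $t<0$ and $D_c^\gamma u$ is associated with $u_0$. Let $v:[0,T_v)\to(\alpha,\beta)$ be continuous, and let $D_c^\gamma v$ be its generalized Caputo derivative associated with $v_0$ (for instance $v_0=v(0)$). 1. If $v_0\le u_0$ and $D_c^\gamma v\le f(t,v)$ in the distributional sense on $(0,T_v)$, then $v(t)\le u(t)$ for all $t\in[0,\min(T_u,T_v))$. 2. If $v_0\ge u_0$ and $D_c^\gamma v\ge f(t,v)$ in the distributional sense on $(0,T_v)$, then $v(t)\ge u(t)$ for all $t\in[0,\min(T_u,T_v))$. -/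

import Mathlib

open Set MeasureTheory TopologicalSpace
open scoped Distributions LineDeriv Convolution

noncomputable section

namespace TimeFractional

/-- The open half-line `(-∞, T)`, where `T` may be `+∞`. -/
def below (T : EReal) : Opens ℝ :=
  ⟨{t : ℝ | (t : EReal) < T}, isOpen_Iio.preimage continuous_coe_real_ereal⟩

/-- The time interval `[0, T)`, where `T` may be `+∞`. -/
def timeInterval (T : EReal) : Set ℝ := {t : ℝ | 0 ≤ t ∧ (t : EReal) < T}

/-- The interval `(α, β)` of states, where `α` may be `-∞` and `β` may be `+∞`. -/
def stateInterval (α β : EReal) : Set ℝ := {x : ℝ | α < (x : EReal) ∧ (x : EReal) < β}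

/-- The distribution `φ ↦ ∫ w φ` on `Ω` defined by a function `w` that is locally integrable
on `Ω` (for other `w` this is the zero distribution). -/
def ofFun (Ω : Opens ℝ) (w : ℝ → ℝ) : 𝓓'(Ω, ℝ) :=
  (TestFunction.integralAgainstBilinCLM (ContinuousLinearMap.mul ℝ ℝ) volume w :
    𝓓(Ω, ℝ) →L[ℝ] ℝ)

/-- The function `θ(t) w(t)`, with `θ` the Heaviside step function. -/
def causal (w : ℝ → ℝ) : ℝ → ℝ := (Ici (0 : ℝ)).indicator w

/-- The distribution `g_β = D(θ(t) t^β) / Γ(1 + β)` on `ℝ`, for `-1 < β < 0`. -/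
def gKernel (β : ℝ) : 𝓓'((⊤ : Opens ℝ), ℝ) :=
  (Real.Gamma (1 + β))⁻¹ • ∂_{(1 : ℝ)} (ofFun ⊤ (causal fun t => t ^ β))

/-- The generalized Caputo derivative of order `γ` of `u : [0, T) → ℝ` associated with the initial
value `u₀`: the distribution `g_{-γ} * ((u - u₀) θ)` on `(-∞, T)`. Since
`g_{-γ} = D(θ t^{-γ}) / Γ(1 - γ)`, this is the distributional derivative of the convolution of the
two locally integrable functions `θ t^{-γ} / Γ(1 - γ)` and `(u - u₀) θ`, both of which vanish for
negative times. The pairing with `g_{-γ}` itself is computed in `caputoDeriv_apply`. -/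
def caputoDeriv (γ : ℝ) (T : EReal) (u : ℝ → ℝ) (u₀ : ℝ) : 𝓓'(below T, ℝ) :=
  (Real.Gamma (1 - γ))⁻¹ • ∂_{(1 : ℝ)} (ofFun (below T)
    ((causal fun t => t ^ (-γ)) ⋆[ContinuousLinearMap.mul ℝ ℝ, volume]
      (causal fun t => u t - u₀)))

/-- Before the time `M`, the convolution in `caputoDeriv` only involves values on `[0, M]`. -/
theorem convolution_eq_truncated (a b : ℝ → ℝ) {M x : ℝ} (hx : x ≤ M) :
    (causal a ⋆[ContinuousLinearMap.mul ℝ ℝ, volume] causal b) x =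
      ((Icc 0 M).indicator a ⋆[ContinuousLinearMap.mul ℝ ℝ, volume] (Icc 0 M).indicator b) x := by
  rw [convolution_def, convolution_def]
  refine integral_congr_ae (Filter.Eventually.of_forall fun s => ?_)
  simp only [causal, ContinuousLinearMap.mul_apply', indicator_apply, mem_Ici, mem_Icc]
  by_cases h1 : 0 ≤ s <;> by_cases h2 : 0 ≤ x - s
  · have h3 : s ≤ M := by linarith
    have h4 : x - s ≤ M := by linarith
    simp [h1, h2, h3, h4]
  · simp [h2]
  · simp [h1]
  · simp [h1]

theorem integrable_kernel {γ : ℝ} (hγ₁ : γ < 1) (M : ℝ) :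
    Integrable ((Icc 0 M).indicator fun t : ℝ => t ^ (-γ)) := by
  rw [integrable_indicator_iff measurableSet_Icc]
  rcases lt_or_ge M 0 with h | h
  · simp [Icc_eq_empty (not_le.2 h)]
  · rw [integrableOn_Icc_iff_integrableOn_Ioc, ← intervalIntegrable_iff_integrableOn_Ioc_of_le h]
    exact intervalIntegral.intervalIntegrable_rpow' (by linarith)

theorem integrable_truncated {T : EReal} {u : ℝ → ℝ}
    (hu : LocallyIntegrableOn u (timeInterval T)) (u₀ : ℝ) {M : ℝ} (hM : (M : EReal) < T) :
    Integrable ((Icc 0 M).indicator fun t => u t - u₀) := by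
  rw [integrable_indicator_iff measurableSet_Icc]
  refine Integrable.sub (hu.integrableOn_compact_subset (fun t ht => ⟨ht.1, ?_⟩) isCompact_Icc) ?_
  · exact lt_of_le_of_lt (EReal.coe_le_coe_iff.2 ht.2) hM
  · exact integrableOn_const (by simp)

/-- The convolution in `caputoDeriv` is locally integrable on `(-∞, T)`. -/
theorem locallyIntegrableOn_convolution {γ : ℝ} (hγ₁ : γ < 1) {T : EReal} {u : ℝ → ℝ}
    (hu : LocallyIntegrableOn u (timeInterval T)) (u₀ : ℝ) :
    LocallyIntegrableOn ((causal fun t => t ^ (-γ)) ⋆[ContinuousLinearMap.mul ℝ ℝ, volume]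
      (causal fun t => u t - u₀)) (below T : Set ℝ) := by
  intro x hx
  obtain ⟨M, hxM, hM⟩ := EReal.lt_iff_exists_real_btwn.1 (show (x : EReal) < T from hx)
  have hxM' : x < M := EReal.coe_lt_coe_iff.1 hxM
  refine ⟨Iic M, mem_nhdsWithin_of_mem_nhds (Iic_mem_nhds hxM'), ?_⟩
  have h := (integrable_kernel hγ₁ M).integrable_convolution (ContinuousLinearMap.mul ℝ ℝ)
    (integrable_truncated hu u₀ hM)
  exact h.integrableOn.congr_fun (fun y hy => (convolution_eq_truncated _ _ hy).symm)
    measurableSet_Iic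

/-- The pairing `⟨g_{-γ} * h, φ⟩ = ⟨g_{-γ}, s ↦ ∫ h(t) φ(s + t) dt⟩` with `h = (u - u₀) θ`: if the
support of `φ` lies in `(-∞, M]`, only the values of `h` on `[0, M]` matter. -/
theorem caputoDeriv_apply {γ : ℝ} (hγ₁ : γ < 1) {T : EReal} {u : ℝ → ℝ}
    (hu : LocallyIntegrableOn u (timeInterval T)) (u₀ : ℝ) {M : ℝ} (hM : (M : EReal) < T)
    (φ : 𝓓(below T, ℝ)) (hφ : tsupport φ ⊆ Iic M) :
    ∃ ψ : 𝓓((⊤ : Opens ℝ), ℝ), (∀ s, ψ s = ∫ t in Icc 0 M, (u t - u₀) * φ (s + t)) ∧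
      caputoDeriv γ T u u₀ φ = gKernel (-γ) ψ := by
  set k : ℝ → ℝ := fun t => t ^ (-γ) with hk
  set b : ℝ → ℝ := (Icc 0 M).indicator fun t => u t - u₀ with hb
  have hbi : Integrable b := integrable_truncated hu u₀ hM
  have hki : Integrable ((Icc 0 M).indicator k) := integrable_kernel hγ₁ M
  have hbn : Integrable fun t => b (-t) := hbi.comp_neg
  have hflip : ∀ (g : ℝ → ℝ) (s : ℝ),
      ((fun t => b (-t)) ⋆[ContinuousLinearMap.mul ℝ ℝ, volume] g) s = ∫ t, b t * g (s + t) := by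
    intro g s
    rw [convolution_def, ← integral_neg_eq_self]
    simp
  have hφ1 : ContDiff ℝ 1 φ := φ.contDiff.of_le (by exact_mod_cast le_top)
  have hsupp : HasCompactSupport fun t => b (-t) := by
    refine HasCompactSupport.intro (K := Icc (-M) 0) isCompact_Icc fun t ht => ?_
    refine indicator_of_notMem (fun h => ht ⟨?_, ?_⟩) _ <;> [linarith [h.2]; linarith [h.1]]
  let ψ : 𝓓((⊤ : Opens ℝ), ℝ) :=
    { toFun := (fun t => b (-t)) ⋆[ContinuousLinearMap.mul ℝ ℝ, volume] φ
      contDiff' := φ.hasCompactSupport.contDiff_convolution_right _ hbn.locallyIntegrable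
        φ.contDiff
      hasCompactSupport' := hsupp.convolution _ φ.hasCompactSupport
      tsupport_subset' := fun _ _ => trivial }
  have hψ : ∀ s, ψ s = ∫ t, b t * φ (s + t) := hflip φ
  have hψd : ∀ s, lineDeriv ℝ ψ s 1 = ∫ t, b t * deriv φ (s + t) := by
    intro s
    rw [← hflip]
    have := φ.hasCompactSupport.hasDerivAt_convolution_right (ContinuousLinearMap.mul ℝ ℝ)
      hbn.locallyIntegrable hφ1 s
    change lineDeriv ℝ ((fun t => b (-t)) ⋆[ContinuousLinearMap.mul ℝ ℝ, volume] φ) s 1 = _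
    rw [this.differentiableAt.lineDeriv_eq_fderiv]
    exact this.deriv
  have hd0 : ∀ x, M < x → deriv φ x = 0 := by
    intro x hx
    by_contra h
    exact absurd (hφ (support_deriv_subset h)) (not_le.2 hx)
  refine ⟨ψ, fun s => ?_, ?_⟩
  · rw [hψ, ← integral_indicator measurableSet_Icc]
    refine integral_congr_ae (Filter.Eventually.of_forall fun t => ?_)
    by_cases ht : t ∈ Icc 0 M <;> simp [hb, ht]
  have hkl : LocallyIntegrableOn (causal k) ((⊤ : Opens ℝ) : Set ℝ) := by
    intro x _
    refine ⟨Iic (x + 1), mem_nhdsWithin_of_mem_nhds (Iic_mem_nhds (by linarith)), ?_⟩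
    refine (integrable_kernel hγ₁ (x + 1)).integrableOn.congr_fun (fun y hy => ?_)
      measurableSet_Iic
    have hy' : y ≤ x + 1 := hy
    simp [causal, indicator_apply, hy', hk]
  have hL : caputoDeriv γ T u u₀ φ = (Real.Gamma (1 - γ))⁻¹ * -∫ x, deriv φ x *
      ((Icc 0 M).indicator k ⋆[ContinuousLinearMap.mul ℝ ℝ, volume] b) x := by
    have : caputoDeriv γ T u u₀ φ = (Real.Gamma (1 - γ))⁻¹ *
      (∂_{(1 : ℝ)} (ofFun (below T) ((causal k) ⋆[ContinuousLinearMap.mul ℝ ℝ, volume]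
      (causal fun t => u t - u₀))) φ) := rfl
    rw [this, Distribution.lineDerivOp_apply_apply, map_neg]
    congr 2
    refine (TestFunction.integralAgainstBilinCLM_eq_integral
      (locallyIntegrableOn_convolution hγ₁ hu u₀)).trans ?_
    refine integral_congr_ae (Filter.Eventually.of_forall fun x => ?_)
    have hx : (∂_{(1 : ℝ)} φ) x = deriv φ x := by
      rw [TestFunction.lineDerivOp_eq_lineDerivCLM ℝ, TestFunction.lineDerivCLM_apply_of_le le_top,
        (hφ1.differentiable one_ne_zero x).lineDeriv_eq_fderiv]
      rfl
    simp only [ContinuousLinearMap.mul_apply', hx]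
    rcases lt_or_ge M x with h | h
    · simp [hd0 x h]
    · rw [convolution_eq_truncated _ _ h]
  have hR : gKernel (-γ) ψ = (Real.Gamma (1 - γ))⁻¹ * -∫ s, (Icc 0 M).indicator k s *
      ∫ t, b t * deriv φ (s + t) := by
    have : gKernel (-γ) ψ = (Real.Gamma (1 + -γ))⁻¹ *
      (∂_{(1 : ℝ)} (ofFun ⊤ (causal k)) ψ) := rfl
    rw [this, Distribution.lineDerivOp_apply_apply, map_neg, ← sub_eq_add_neg]
    congr 2
    refine (TestFunction.integralAgainstBilinCLM_eq_integral hkl).trans ?_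
    refine integral_congr_ae (Filter.Eventually.of_forall fun s => ?_)
    have hs : (∂_{(1 : ℝ)} ψ) s = ∫ t, b t * deriv φ (s + t) := by
      rw [TestFunction.lineDerivOp_eq_lineDerivCLM ℝ, TestFunction.lineDerivCLM_apply_of_le le_top,
        hψd]
    simp only [ContinuousLinearMap.mul_apply', hs]
    rw [mul_comm]
    rcases lt_or_ge M s with h | h
    · have : ∫ t, b t * deriv φ (s + t) = 0 := by
        refine integral_eq_zero_of_ae (Filter.Eventually.of_forall fun t => ?_)
        by_cases ht : t ∈ Icc 0 M
        · simp [hd0 (s + t) (by linarith [ht.1])]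
        · simp [hb, ht]
      simp [this]
    · simp [causal, indicator_apply, h]
  rw [hL, hR]
  congr 2
  have hint : Integrable (fun p : ℝ × ℝ => deriv φ p.1 * ((Icc 0 M).indicator k p.2 *
      b (p.1 - p.2))) (volume.prod volume) := by
    have h := hki.convolution_integrand (ContinuousLinearMap.mul ℝ ℝ) hbi
    have hc : Continuous (deriv φ) := hφ1.continuous_deriv le_rfl
    obtain ⟨C, hC⟩ := hc.bounded_above_of_compact_support φ.hasCompactSupport.deriv
    exact h.bdd_mul (c := C) (hc.comp continuous_fst).aestronglyMeasurable
      (Filter.Eventually.of_forall fun p => hC p.1)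
  calc ∫ x, deriv φ x * ((Icc 0 M).indicator k ⋆[ContinuousLinearMap.mul ℝ ℝ, volume] b) x
      = ∫ x, ∫ s, deriv φ x * ((Icc 0 M).indicator k s * b (x - s)) := by
        refine integral_congr_ae (Filter.Eventually.of_forall fun x => ?_)
        simp only [convolution_def, ContinuousLinearMap.mul_apply']
        rw [integral_const_mul]
    _ = ∫ s, ∫ x, deriv φ x * ((Icc 0 M).indicator k s * b (x - s)) := integral_integral_swap hint
    _ = ∫ s, (Icc 0 M).indicator k s * ∫ t, b t * deriv φ (s + t) := by
        refine integral_congr_ae (Filter.Eventually.of_forall fun s => ?_)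
        simp only
        rw [← integral_const_mul, ← integral_add_left_eq_self _ s]
        refine integral_congr_ae (Filter.Eventually.of_forall fun t => ?_)
        simp only [add_sub_cancel_left]
        ring

/-- `F ≤ G` on `(0, T)` in the distributional sense, for distributions `F`, `G` on `(-∞, T)`. -/
def DistLE {T : EReal} (F G : 𝓓'(below T, ℝ)) : Prop :=
  ∀ φ : 𝓓(below T, ℝ), (∀ t, 0 ≤ φ t) → tsupport φ ⊆ Ioi (0 : ℝ) → F φ ≤ G φ

/-- The distribution `f(t, u(t))` on `(-∞, T)`, supported in `[0, T)`. -/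
def rhs (T : EReal) (f : ℝ → ℝ → ℝ) (u : ℝ → ℝ) : 𝓓'(below T, ℝ) :=
  ofFun (below T) (causal fun t => f t (u t))

/-- `u` is a weak solution of `D_c^γ u = f(t, u)` on `[0, T)` with initial value `u₀`. -/
structure IsWeakSolution (γ : ℝ) (T : EReal) (f : ℝ → ℝ → ℝ) (u : ℝ → ℝ) (u₀ : ℝ) : Prop where
  locallyIntegrable : LocallyIntegrableOn u (timeInterval T)
  locallyIntegrable_rhs : LocallyIntegrableOn (fun t => f t (u t)) (timeInterval T)
  equation : caputoDeriv γ T u u₀ = rhs T f u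

/-- `f` is locally Lipschitz in its second variable on `[0, ∞) × (α, β)`: on every compact subset,
`f` is Lipschitz in that variable with a constant independent of time. -/
def LocallyLipschitzInState (f : ℝ → ℝ → ℝ) (α β : EReal) : Prop :=
  ∀ K : Set (ℝ × ℝ), IsCompact K → K ⊆ Ici (0 : ℝ) ×ˢ stateInterval α β →
    ∃ L : ℝ, ∀ t x y : ℝ, (t, x) ∈ K → (t, y) ∈ K → |f t x - f t y| ≤ L * |x - y|

end TimeFractional

end

/-!
A solution is both a weak subsolution and a weak supersolution, so both parts follow from one
comparison principle, `le_of_subsolution_of_supersolution`.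

Put `k(t) = θ(t) t ^ (-γ)`, with `θ` the Heaviside function. For continuous `w` the function
`k * ((w - w₀) θ)` is continuous and vanishes for `t ≤ 0`. Its distributional derivative therefore has
no atom at time `0`, and an inequality for this derivative on `(0, T)` bounds the increments of the
function on all of `(-∞, T)` (`sub_le_integral_causal_of_weak`). Subtracting the bounds for a
subsolution `v` and a supersolution `w`, and using that `f` is Lipschitz along their graphs, gives
`(k * (d θ))' ≤ L |d|` for `d = v - w`, in integrated form; the initial values add the term
`(v₀ - w₀) k`, which has the right sign.

That this forces `d ≤ 0` is a maximum principle argument (`nonpos_of_memory_sub_le`). The initial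
value satisfies `d(0) ≤ 0` because `k` is unbounded near `0`. Suppose `d ≤ 0` up to a time `τ₀` and
not beyond, so that `d(τ₀) = 0`. As `k` is unbounded, `δ θ(t - τ₀)` is a strict supersolution of
`(k * z)' = L z` for a short time after `τ₀`, for every `δ > 0`. If an average of `d` over a short
preceding window touches this barrier from below, then at the first time of contact the derivative
of `k * (average - barrier)` is negative by the inequalities; but it is nonnegative, because `k` is
nonincreasing and the average is Lipschitz (`memory_sub_le_of_touch`). Averages are needed here
because `d` itself is only continuous, and they commute with convolution. Hence `d ≤ 2 δ` shortly
after `τ₀` for every `δ`, contradicting the choice of `τ₀` (`exists_nonpos_extension`).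
-/

namespace TimeFractional

/-! ### Convolution with a singular kernel, and averages over time -/

/-- The properties of the kernel `s ↦ s ^ (-γ)`, cut off after some time, on which the comparison
principle rests: it is causal, nonnegative, integrable, nonincreasing on `(0, ∞)`, unbounded near
`0`, and `o(1 / r)` there. Nothing is required of the value at `0` beyond its sign. -/
structure IsSingularKernel (k : ℝ → ℝ) : Prop where
  integrable : Integrable k
  nonneg : ∀ s, 0 ≤ k s
  eq_zero_of_neg : ∀ s, s < 0 → k s = 0
  antitoneOn : AntitoneOn k (Ioi 0)
  unbounded : ∀ C, ∃ τ > 0, C ≤ k τ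
  small : ∀ ε > 0, ∃ ρ > 0, ∀ r, 0 < r → r < ρ → r * k r ≤ ε

/-- The convolution `k * D`. It only differs from Mathlib's `convolution` in being a plain integral
of a product. -/
noncomputable def memory (k D : ℝ → ℝ) (t : ℝ) : ℝ := ∫ s, k s * D (t - s)

/-- The Steklov average of `D` over the preceding time window `[t - h, t]`. It commutes with
convolution, and turns a bounded function into a Lipschitz one. -/
noncomputable def steklov (h : ℝ) (D : ℝ → ℝ) (t : ℝ) : ℝ := h⁻¹ * ∫ σ in (0 : ℝ)..h, D (t - σ)

section Bounded

variable {D : ℝ → ℝ} {B : ℝ}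

theorem intervalIntegrable_of_bounded (hD : Measurable D) (hB : ∀ s, |D s| ≤ B) (a b : ℝ) :
    IntervalIntegrable D volume a b :=
  (intervalIntegrable_const (c := B)).mono_fun hD.aestronglyMeasurable
    (Filter.Eventually.of_forall fun s => by
      simpa using (hB s).trans (le_abs_self B))

theorem steklov_eq (h : ℝ) (D : ℝ → ℝ) (t : ℝ) :
    steklov h D t = h⁻¹ * ∫ s in (t - h)..t, D s := by
  rw [steklov, intervalIntegral.integral_comp_sub_left (fun s => D s) t, sub_zero]

theorem steklov_le {h t c : ℝ} (hh : 0 < h) (hD : Measurable D) (hB : ∀ s, |D s| ≤ B)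
    (hc : ∀ s ∈ Icc (t - h) t, D s ≤ c) : steklov h D t ≤ c := by
  have := intervalIntegral.integral_mono_on (by linarith : t - h ≤ t)
    (intervalIntegrable_of_bounded hD hB _ _) (intervalIntegrable_const (c := c)) hc
  rw [intervalIntegral.integral_const, smul_eq_mul, sub_sub_cancel] at this
  rw [steklov_eq, inv_mul_le_iff₀ hh]
  exact this

theorem le_steklov {h t c : ℝ} (hh : 0 < h) (hD : Measurable D) (hB : ∀ s, |D s| ≤ B)
    (hc : ∀ s ∈ Icc (t - h) t, c ≤ D s) : c ≤ steklov h D t := by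
  have := intervalIntegral.integral_mono_on (by linarith : t - h ≤ t)
    (intervalIntegrable_const (c := c)) (intervalIntegrable_of_bounded hD hB _ _) hc
  rw [intervalIntegral.integral_const, smul_eq_mul, sub_sub_cancel] at this
  rw [steklov_eq, le_inv_mul_iff₀ hh]
  exact this

theorem abs_steklov_le {h : ℝ} (hh : 0 < h) (hD : Measurable D) (hB : ∀ s, |D s| ≤ B) (t : ℝ) :
    |steklov h D t| ≤ B :=
  abs_le.2 ⟨le_steklov hh hD hB fun s _ => (abs_le.1 (hB s)).1,
    steklov_le hh hD hB fun s _ => (abs_le.1 (hB s)).2⟩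

theorem abs_steklov_sub_le {h : ℝ} (hh : 0 < h) (hD : Measurable D) (hB : ∀ s, |D s| ≤ B)
    (a b : ℝ) : |steklov h D b - steklov h D a| ≤ 2 * B / h * |b - a| := by
  have hi := intervalIntegrable_of_bounded hD hB
  have e : steklov h D b - steklov h D a =
      h⁻¹ * ((∫ s in a..b, D s) - ∫ s in (a - h)..(b - h), D s) := by
    rw [steklov_eq, steklov_eq, ← mul_sub,
      intervalIntegral.integral_interval_sub_interval_comm (hi _ _) (hi _ _) (hi _ _),
      intervalIntegral.integral_symm b a, intervalIntegral.integral_symm (b - h) (a - h)]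
    ring
  have h1 : |∫ s in a..b, D s| ≤ B * |b - a| :=
    intervalIntegral.norm_integral_le_of_norm_le_const (f := D) fun s _ => hB s
  have h2 : |∫ s in (a - h)..(b - h), D s| ≤ B * |b - h - (a - h)| :=
    intervalIntegral.norm_integral_le_of_norm_le_const (f := D) fun s _ => hB s
  rw [sub_sub_sub_cancel_right] at h2
  rw [e, abs_mul, abs_of_pos (inv_pos.2 hh), div_eq_inv_mul, mul_assoc]
  refine mul_le_mul_of_nonneg_left ?_ (inv_pos.2 hh).le
  exact (abs_sub _ _).trans (by linarith)

theorem continuous_steklov {h : ℝ} (hh : 0 < h) (hD : Measurable D) (hB : ∀ s, |D s| ≤ B) :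
    Continuous (steklov h D) := by
  have hB0 : 0 ≤ B := (abs_nonneg _).trans (hB 0)
  refine (LipschitzWith.of_dist_le_mul (K := ⟨2 * B / h, by positivity⟩) fun x y => ?_).continuous
  exact abs_steklov_sub_le hh hD hB y x

variable {k : ℝ → ℝ}

theorem integrable_memory (hk : Integrable k) (hD : Measurable D) (hB : ∀ s, |D s| ≤ B) (t : ℝ) :
    Integrable fun s => k s * D (t - s) :=
  hk.mul_bdd (c := B) (hD.comp (measurable_const.sub measurable_id)).aestronglyMeasurable
    (Filter.Eventually.of_forall fun _ => hB _)

theorem memory_steklov {h : ℝ} (hh : 0 < h) (hk : Integrable k) (hD : Measurable D)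
    (hB : ∀ s, |D s| ≤ B) (t : ℝ) :
    memory k (steklov h D) t = steklov h (memory k D) t := by
  simp only [memory, steklov, mul_left_comm (k _) h⁻¹]
  rw [integral_const_mul]
  congr 1
  simp only [intervalIntegral.integral_of_le hh.le, ← integral_const_mul]
  have hi : Integrable (Function.uncurry fun s σ => k s * D (t - s - σ))
      (volume.prod (volume.restrict (Ioc 0 h))) := by
    refine (hk.comp_fst (volume.restrict (Ioc 0 h))).mul_bdd (c := B)
      (Measurable.aestronglyMeasurable ?_)
      (Filter.Eventually.of_forall fun _ => hB _)
    exact hD.comp (by fun_prop)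
  rw [integral_integral_swap hi]
  simp only [sub_right_comm]

/-- The maximum principle for `(k * z)'`: if `z ≤ 0` up to time `t₁` and `z` falls off at most
linearly backwards from `t₁`, then the increment of `k * z` over `[a, t₁]` is bounded below
by `-o(t₁ - a)`, so that formally `(k * z)'(t₁) ≥ 0`. Monotonicity of `k` makes the contribution of
the past before `a` nonnegative. -/
theorem memory_sub_le_of_touch (hk : IsSingularKernel k) {z : ℝ → ℝ} (hz : Measurable z)
    (hB : ∀ s, |z s| ≤ B) {t₁ a C ε : ℝ} (hC : 0 ≤ C) (ha : a ≤ t₁)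
    (hz0 : ∀ s ≤ t₁, z s ≤ 0) (hzC : ∀ s ∈ Icc a t₁, -(C * (t₁ - s)) ≤ z s)
    (hε : ∀ r, 0 < r → r < t₁ - a → r * k r ≤ ε) :
    -(C * ε * (t₁ - a)) ≤ memory k z t₁ - memory k z a := by
  -- Both integrals are written against `z (t₁ - s)`, so that only the kernels differ.
  have e : memory k z a = ∫ s, k (s - (t₁ - a)) * z (t₁ - s) := by
    rw [memory, ← integral_sub_right_eq_self _ (t₁ - a)]
    congr 1; ext s; congr 2; ring
  have i2 : Integrable fun s => k (s - (t₁ - a)) * z (t₁ - s) :=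
    (hk.integrable.comp_sub_right (t₁ - a)).mul_bdd (c := B)
      (hz.comp (measurable_const.sub measurable_id)).aestronglyMeasurable
      (Filter.Eventually.of_forall fun _ => hB _)
  rw [e, memory, ← integral_sub (integrable_memory hk.integrable hz hB _) i2]
  have e2 : -(C * ε * (t₁ - a)) = ∫ s, (Ioo 0 (t₁ - a)).indicator (fun _ => -(C * ε)) s := by
    rw [integral_indicator measurableSet_Ioo, setIntegral_const]
    simp [Measure.real, ha]
    ring
  rw [e2]
  refine integral_mono_ae ?_ ((integrable_memory hk.integrable hz hB _).sub i2) ?_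
  · exact (integrable_indicator_iff measurableSet_Ioo).2 (integrableOn_const (by simp))
  filter_upwards [(measure_eq_zero_iff_ae_notMem.1 (measure_singleton (μ := volume) (0 : ℝ))),
    (measure_eq_zero_iff_ae_notMem.1 (measure_singleton (μ := volume) (t₁ - a)))] with s h0 h1
  have h0' : s ≠ 0 := h0
  have h1' : s ≠ t₁ - a := h1
  rw [← sub_mul]
  rcases lt_or_gt_of_ne h0' with hs | hs
  · rw [hk.eq_zero_of_neg s hs, hk.eq_zero_of_neg _ (by linarith : s - (t₁ - a) < 0)]
    rw [indicator_of_notMem (by simp [hs.le])]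
    simp
  rcases lt_or_gt_of_ne h1' with hs1 | hs1
  · rw [indicator_of_mem (by exact ⟨hs, hs1⟩), hk.eq_zero_of_neg (s - (t₁ - a)) (by linarith),
      sub_zero]
    have h2 := hzC (t₁ - s) ⟨by linarith, by linarith⟩
    rw [sub_sub_cancel] at h2
    have h3 := mul_le_mul_of_nonneg_left h2 (hk.nonneg s)
    have h4 := mul_le_mul_of_nonneg_left (hε s hs hs1) hC
    linarith [mul_comm (k s) (C * s), mul_assoc C s (k s)]
  · rw [indicator_of_notMem (by simp [hs1.le])]
    have h2 := hk.antitoneOn (show s - (t₁ - a) ∈ Ioi (0 : ℝ) from sub_pos.2 hs1) hs (by linarith)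
    exact mul_nonneg_of_nonpos_of_nonpos (by linarith) (hz0 _ (by linarith))

theorem memory_indicator_Ici (k : ℝ → ℝ) (τ t : ℝ) :
    memory k ((Ici τ).indicator fun _ => (1 : ℝ)) t = ∫ s in Iic (t - τ), k s := by
  rw [memory, ← integral_indicator measurableSet_Iic]
  congr 1; ext s
  by_cases hs : s ≤ t - τ
  · simp [hs, show τ ≤ t - s by linarith]
  · simp [hs, show ¬ τ ≤ t - s by intro h; exact hs (by linarith)]

theorem memory_indicator_Ici_sub (hk : Integrable k) (τ a b : ℝ) :
    memory k ((Ici τ).indicator fun _ => (1 : ℝ)) b -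
      memory k ((Ici τ).indicator fun _ => (1 : ℝ)) a = ∫ s in (a - τ)..(b - τ), k s := by
  rw [memory_indicator_Ici, memory_indicator_Ici]
  exact intervalIntegral.integral_Iic_sub_Iic hk.integrableOn hk.integrableOn

theorem IsSingularKernel.mul_le_integral (hk : IsSingularKernel k) {a b τ : ℝ} (ha : 0 ≤ a)
    (hab : a ≤ b) (hb : b ≤ τ) : k τ * (b - a) ≤ ∫ s in a..b, k s := by
  have := intervalIntegral.integral_mono_on_of_le_Ioo hab
    (intervalIntegrable_const (c := k τ)) hk.integrable.intervalIntegrable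
    (fun s hs => hk.antitoneOn (show s ∈ Ioi (0 : ℝ) from lt_of_le_of_lt ha hs.1)
      (show τ ∈ Ioi (0 : ℝ) from ha.trans_lt (hs.1.trans (hs.2.trans_le hb)))
      (hs.2.le.trans hb))
  rwa [intervalIntegral.integral_const, smul_eq_mul, mul_comm] at this

end Bounded

theorem measurable_causal {d : ℝ → ℝ} (hd : Continuous d) : Measurable (causal d) :=
  hd.measurable.indicator measurableSet_Ici

theorem intervalIntegrable_causal {d : ℝ → ℝ} (hd : Continuous d) (a b : ℝ) :
    IntervalIntegrable (causal d) volume a b := by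
  rw [intervalIntegrable_iff]
  exact ((hd.intervalIntegrable a b).def').indicator measurableSet_Ici

theorem abs_causal_le {d : ℝ → ℝ} {B : ℝ} (hB : ∀ s, |d s| ≤ B) (s : ℝ) : |causal d s| ≤ B := by
  by_cases hs : 0 ≤ s
  · simpa [causal, hs] using hB s
  · simpa [causal, hs] using (abs_nonneg _).trans (hB s)

/-- `causal d` may jump at `0`, but for fixed `t` this affects the integrand of `k * causal d` at
the single point `s = t`. -/
theorem continuous_memory_causal {k d : ℝ → ℝ} {B : ℝ} (hk : Integrable k) (hd : Continuous d)
    (hB : ∀ s, |d s| ≤ B) : Continuous (memory k (causal d)) := by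
  refine continuous_iff_continuousAt.2 fun t => ?_
  refine continuousAt_of_dominated (bound := fun s => ‖k s‖ * B) ?_ ?_
    (hk.norm.mul_const B) ?_
  · exact Filter.Eventually.of_forall fun x =>
      (integrable_memory hk (measurable_causal hd) (abs_causal_le hB) x).aestronglyMeasurable
  · refine Filter.Eventually.of_forall fun x => Filter.Eventually.of_forall fun s => ?_
    rw [norm_mul]
    exact mul_le_mul_of_nonneg_left (abs_causal_le hB _) (norm_nonneg _)
  · filter_upwards [(measure_eq_zero_iff_ae_notMem.1 (measure_singleton (μ := volume) t))]
      with s hs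
    have hs' : t - s ≠ 0 := fun h => hs (by rw [mem_singleton_iff]; linarith)
    refine continuousAt_const.mul (ContinuousAt.comp (g := causal d) ?_ (by fun_prop))
    rcases lt_or_gt_of_ne hs' with h | h
    · refine (continuousAt_const (y := (0:ℝ))).congr ?_
      filter_upwards [Iio_mem_nhds h] with y hy
      simp [causal, not_le.2 (mem_Iio.1 hy)]
    · refine hd.continuousAt.congr ?_
      filter_upwards [Ioi_mem_nhds h] with y hy
      simp [causal, (mem_Ioi.1 hy).le]

/-- If `(k * D)' ≤ g` and `g ≤ G` on a window that contains all the averaging intervals, then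
the Steklov average of `k * D` has slope at most `G`. -/
theorem steklov_memory_sub_le {k D g : ℝ → ℝ} {h a b G M : ℝ} (hh : 0 < h) (hab : a ≤ b)
    (hb : b < M) (hc : Continuous (memory k D)) (hg : ∀ x y, IntervalIntegrable g volume x y)
    (hG : ∀ s ∈ Icc (a - h) b, g s ≤ G)
    (H : ∀ x y, x ≤ y → y < M → memory k D y - memory k D x ≤ ∫ s in x..y, g s) :
    steklov h (memory k D) b - steklov h (memory k D) a ≤ G * (b - a) := by
  rw [steklov, steklov, ← mul_sub, ← intervalIntegral.integral_sub, inv_mul_le_iff₀ hh]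
  · have := intervalIntegral.integral_mono_on (g := fun _ => G * (b - a)) hh.le
      (Continuous.intervalIntegrable (u := fun σ => memory k D (b - σ) - memory k D (a - σ))
        (by fun_prop) 0 h)
      (intervalIntegrable_const (μ := volume)) (fun σ hσ => ?_)
    · rwa [intervalIntegral.integral_const, smul_eq_mul, sub_zero] at this
    · refine (H _ _ (by linarith) (by linarith [hσ.1])).trans ?_
      have := intervalIntegral.integral_mono_on (g := fun _ => G) (by linarith : a - σ ≤ b - σ)
        (hg _ _) intervalIntegrable_const
        (fun s hs => hG s ⟨by linarith [hs.1, hσ.2], by linarith [hs.2, hσ.1]⟩)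
      rw [intervalIntegral.integral_const, smul_eq_mul] at this
      linarith
  · exact Continuous.intervalIntegrable (by fun_prop) _ _
  · exact Continuous.intervalIntegrable (by fun_prop) _ _

theorem exists_first_time {S : ℝ → ℝ} (hS : Continuous S) {τ t δ : ℝ} (hτt : τ ≤ t)
    (hτ : S τ < δ) (ht : δ ≤ S t) :
    ∃ t₁, τ < t₁ ∧ t₁ ≤ t ∧ S t₁ = δ ∧ ∀ s, τ ≤ s → s ≤ t₁ → S s ≤ δ := by
  obtain ⟨t₁, h1, h2⟩ := (isCompact_Icc.inter_right (isClosed_Ici.preimage hS)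
    : IsCompact (Icc τ t ∩ S ⁻¹' Ici δ)).exists_isLeast ⟨t, ⟨hτt, le_rfl⟩, ht⟩
  have hlt : ∀ s, τ ≤ s → s < t₁ → S s < δ := fun s hs hs1 => by
    by_contra hn
    exact absurd (h2 ⟨⟨hs, hs1.le.trans h1.1.2⟩, not_lt.1 hn⟩) (not_le.2 hs1)
  have hτt1 : τ < t₁ := lt_of_le_of_ne h1.1.1 fun h => by
    have : δ ≤ S t₁ := h1.2
    rw [← h] at this; linarith
  have hle : S t₁ ≤ δ := by
    refine le_of_tendsto (hS.continuousWithinAt (s := Iio t₁) (x := t₁)) ?_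
    filter_upwards [Ioo_mem_nhdsLT hτt1] with s hs using (hlt s hs.1.le hs.2).le
  exact ⟨t₁, hτt1, h1.1.2, le_antisymm hle h1.2, fun s hs hs1 => by
    rcases hs1.eq_or_lt with h | h
    · exact h ▸ hle
    · exact (hlt s hs h).le⟩

/-- From `τ₀` on, `causal d` has a modulus of continuity looking backwards in time, even if the
window reaches into negative times: that happens only when `x` is close to `τ₀`, where `d` is close
to `d τ₀ = 0`, the value of `causal d` before time `0`. -/
theorem causal_uniform {d : ℝ → ℝ} (hd : Continuous d) {τ₀ M ω : ℝ} (hω : 0 < ω) (hτ : 0 ≤ τ₀)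
    (h0 : d τ₀ = 0) : ∃ η > 0, ∀ x ∈ Icc τ₀ M, ∀ s, x - η < s → s ≤ x →
      |causal d s - causal d x| ≤ ω := by
  obtain ⟨η, hη, h⟩ := Metric.uniformContinuousOn_iff.1
    (isCompact_Icc.uniformContinuousOn_of_continuous (hd.continuousOn (s := Icc 0 M))) ω hω
  refine ⟨η, hη, fun x hx s hs hsx => ?_⟩
  have hx0 : 0 ≤ x := hτ.trans hx.1
  by_cases hs0 : 0 ≤ s
  · simp only [causal, indicator_apply, mem_Ici, hs0, hx0, if_true]
    refine (h s ⟨hs0, hsx.trans hx.2⟩ x ⟨hx0, hx.2⟩ ?_).le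
    rw [Real.dist_eq, abs_lt]; constructor <;> linarith
  · simp only [causal, indicator_apply, mem_Ici, hs0, hx0, if_true, if_false]
    rw [← h0]
    refine (h τ₀ ⟨hτ, hx.1.trans hx.2⟩ x ⟨hx0, hx.2⟩ ?_).le
    rw [Real.dist_eq, abs_lt]; constructor <;> linarith [hx.1, not_le.1 hs0]

theorem causal_le_mul_abs {d g : ℝ → ℝ} {L : ℝ} (hgd : ∀ s, g s ≤ L * |d s|) (s : ℝ) :
    causal g s ≤ L * |causal d s| := by
  by_cases hs : 0 ≤ s
  · simpa [causal, hs] using hgd s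
  · simp [causal, hs]

theorem memory_causal_of_nonpos {k : ℝ → ℝ} (hk : ∀ s, s < 0 → k s = 0) (d : ℝ → ℝ) {x : ℝ}
    (hx : x ≤ 0) : memory k (causal d) x = 0 := by
  refine integral_eq_zero_of_ae ?_
  filter_upwards [(measure_eq_zero_iff_ae_notMem.1 (measure_singleton (μ := volume) (0 : ℝ)))]
    with s hs
  have hs' : s ≠ 0 := hs
  rcases lt_or_gt_of_ne hs' with h | h
  · simp [hk s h]
  · simp [causal, show x < s by linarith]

/-! ### The comparison principle for the linearized inequality -/

section Comparison

variable {k d g : ℝ → ℝ} {B L M : ℝ}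

/-- The sign `d ≤ 0` propagates from `[0, τ₀]` to a slightly longer interval. If not, an average `S`
of `d` over a short window reaches a level `δ > 0`, for the first time at `t₁`. At that time
`z = S - δ θ(t - τ₀)` touches `0` from below, so `(k * z)'(t₁) ≥ 0` by `memory_sub_le_of_touch`. But
`(k * S)' ≤ L (δ + 2ω)`, with `ω` the oscillation of `d` over the window, while
`(k * θ(t - τ₀))' = k (t - τ₀) ≥ L + 1`. -/
theorem exists_nonpos_extension (hk : IsSingularKernel k) (hd : Continuous d)
    (hB : ∀ s, |d s| ≤ B) (hg : Continuous g) (hL : 0 ≤ L) (hgd : ∀ s, g s ≤ L * |d s|)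
    (H : ∀ a b, a ≤ b → b < M →
      memory k (causal d) b - memory k (causal d) a ≤ ∫ s in a..b, causal g s)
    {τ₀ : ℝ} (hτ₀ : 0 ≤ τ₀) (h0 : d τ₀ = 0) (hneg : ∀ s, 0 ≤ s → s ≤ τ₀ → d s ≤ 0) :
    ∃ τ > 0, ∀ t, τ₀ ≤ t → t ≤ τ₀ + τ → t < M → d t ≤ 0 := by
  -- The barrier `δ θ(t - τ₀)` is a strict supersolution as long as `k (t - τ₀) ≥ L + 1`.
  obtain ⟨τ, hτ, hkτ⟩ := hk.unbounded (L + 1)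
  refine ⟨τ, hτ, fun t htτ htτ' htM => ?_⟩
  set D := causal d with hD
  have hDm : Measurable D := measurable_causal hd
  have hDB : ∀ s, |D s| ≤ B := abs_causal_le hB
  have hB0 : 0 ≤ B := (abs_nonneg _).trans (hB 0)
  have hDt : D t = d t := by simp [hD, causal, hτ₀.trans htτ]
  have hDneg : ∀ s, s ≤ τ₀ → D s ≤ 0 := fun s hs => by
    by_cases hs0 : 0 ≤ s
    · simpa [hD, causal, hs0] using hneg s hs0 hs
    · simp [hD, causal, hs0]
  refine le_of_forall_pos_le_add fun δ' hδ' => ?_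
  set δ := δ' / 2 with hδ_def
  have hδ : 0 < δ := by positivity
  -- `ω` is chosen so that `L (δ + 2ω) ≤ L δ + δ / 2`.
  set ω := δ / (4 * (L + 1)) with hω_def
  have hω : 0 < ω := by positivity
  have hωL : ω * (4 * (L + 1)) = δ := div_mul_cancel₀ _ (by positivity)
  obtain ⟨η, hη, hmod⟩ := causal_uniform (M := t) hd hω hτ₀ h0
  -- The windows `[s - h, s]` with `s ∈ [t₁ - h, t₁]` lie in `(t₁ - η, t₁]`.
  set h := η / 3 with hh_def
  have hh : 0 < h := by positivity
  set S := steklov h D with hS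
  have hSc : Continuous S := continuous_steklov hh hDm hDB
  have hSB : ∀ s, |S s| ≤ B := abs_steklov_le hh hDm hDB
  have hSneg : ∀ s, s ≤ τ₀ → S s ≤ 0 := fun s hs =>
    steklov_le hh hDm hDB fun r hr => hDneg r (hr.2.trans hs)
  have hSt : D t - ω ≤ S t := le_steklov hh hDm hDB fun s hs => by
    have := (abs_le.1 (hmod t ⟨htτ, le_rfl⟩ s (by linarith [hs.1]) hs.2)).1
    linarith
  have key : S t ≤ δ := by
    by_contra hcon
    obtain ⟨t₁, ht₁, ht₁t, hSt₁, hfirst⟩ :=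
      exists_first_time hSc htτ ((hSneg τ₀ le_rfl).trans_lt hδ) (not_le.1 hcon).le
    have hmod₁ := hmod t₁ ⟨ht₁.le, ht₁t⟩
    have hD₁ : D t₁ ≤ δ + ω := by
      have : D t₁ - ω ≤ S t₁ := le_steklov hh hDm hDB fun s hs => by
        have := (abs_le.1 (hmod₁ s (by linarith [hs.1]) hs.2)).1
        linarith
      linarith
    have hD₁' : δ - ω ≤ D t₁ := by
      have : S t₁ ≤ D t₁ + ω := steklov_le hh hDm hDB fun s hs => by
        have := (abs_le.1 (hmod₁ s (by linarith [hs.1]) hs.2)).2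
        linarith
      linarith
    have hDs : ∀ s, t₁ - η < s → s ≤ t₁ → |D s| ≤ δ + 2 * ω := fun s hs hs1 => by
      have := abs_le.1 (hmod₁ s hs hs1)
      rw [abs_le]; constructor <;> linarith
    set C := 2 * B / h with hC_def
    have hC : 0 ≤ C := by positivity
    obtain ⟨ρ, hρ, hsmall⟩ := hk.small (δ / (4 * (C + 1))) (by positivity)
    obtain ⟨a, ha, hat₁⟩ : ∃ a, max τ₀ (max (t₁ - h) (t₁ - ρ)) < a ∧ a < t₁ :=
      exists_between (by simp [ht₁, hh, hρ])
    rw [max_lt_iff, max_lt_iff] at ha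
    obtain ⟨haτ, hah, haρ⟩ := ha
    set E : ℝ → ℝ := (Ici τ₀).indicator fun _ => (1 : ℝ) with hE
    have hEm : Measurable E := measurable_const.indicator measurableSet_Ici
    have hEB : ∀ s, |E s| ≤ 1 := fun s => by
      by_cases hs : τ₀ ≤ s <;> simp [hE, hs]
    set z : ℝ → ℝ := fun s => S s - δ * E s with hz
    have hmz : ∀ x, memory k z x = memory k S x - δ * memory k E x := fun x => by
      simp only [memory, hz, ← integral_const_mul]
      rw [← integral_sub (integrable_memory hk.integrable hSc.measurable hSB x)
        ((integrable_memory hk.integrable hEm hEB x).const_mul δ)]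
      congr 1; ext s; ring
    have hup : memory k S t₁ - memory k S a ≤ L * (δ + 2 * ω) * (t₁ - a) := by
      rw [hS, memory_steklov hh hk.integrable hDm hDB, memory_steklov hh hk.integrable hDm hDB]
      refine steklov_memory_sub_le (g := causal g) (M := M) hh hat₁.le (ht₁t.trans_lt htM)
        (continuous_memory_causal hk.integrable hd hB) (intervalIntegrable_causal hg)
        (fun s hs => ?_) H
      exact (causal_le_mul_abs hgd s).trans
        (mul_le_mul_of_nonneg_left (hDs s (by linarith [hs.1]) hs.2) hL)
    have hE' : k τ * (t₁ - a) ≤ memory k E t₁ - memory k E a := by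
      rw [hE, memory_indicator_Ici_sub hk.integrable]
      have := hk.mul_le_integral (a := a - τ₀) (b := t₁ - τ₀) (τ := τ) (by linarith)
        (by linarith) (by linarith)
      rwa [sub_sub_sub_cancel_right] at this
    -- `C` is the Lipschitz constant of `S`, and `C ε ≤ δ / 4` for the `ε` used here.
    have hlow := memory_sub_le_of_touch hk (z := z) (B := B + δ) (t₁ := t₁) (a := a) (C := C)
      (ε := δ / (4 * (C + 1))) (hSc.measurable.sub (hEm.const_mul δ))
      (fun s => by
        refine (abs_sub _ _).trans (add_le_add (hSB s) ?_)
        rw [abs_mul, abs_of_pos hδ]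
        exact mul_le_of_le_one_right hδ.le (hEB s)) hC hat₁.le
      (fun s hs => by
        by_cases hs0 : τ₀ ≤ s
        · simpa [hz, hE, hs0] using hfirst s hs0 hs
        · simpa [hz, hE, hs0] using hSneg s (not_le.1 hs0).le)
      (fun s hs => by
        have h1 := (abs_le.1 (abs_steklov_sub_le hh hDm hDB s t₁)).2
        rw [abs_of_nonneg (by linarith [hs.2])] at h1
        have h2 : τ₀ ≤ s := haτ.le.trans hs.1
        simp only [hz, hE, indicator_apply, mem_Ici, h2, if_true]
        linarith)
      (fun r hr hr' => hsmall r hr (by linarith))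
    rw [hmz, hmz] at hlow
    have hpos : 0 < t₁ - a := by linarith
    have h1 : C * (δ / (4 * (C + 1))) ≤ δ / 4 := by
      rw [mul_div_assoc', div_le_div_iff₀ (by positivity) (by positivity)]
      nlinarith
    have h2 : L * (δ + 2 * ω) ≤ L * δ + δ / 2 := by nlinarith
    have h3 : δ * (L + 1) * (t₁ - a) ≤ δ * (memory k E t₁ - memory k E a) := by
      rw [mul_assoc]
      exact mul_le_mul_of_nonneg_left
        ((mul_le_mul_of_nonneg_right hkτ hpos.le).trans hE') hδ.le
    have h4 := mul_le_mul_of_nonneg_right h1 hpos.le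
    have h5 := mul_le_mul_of_nonneg_right h2 hpos.le
    have h6 : 0 < δ * (t₁ - a) := mul_pos hδ hpos
    nlinarith
  have hωδ : ω ≤ δ := by nlinarith
  linarith

/-- The initial value has the right sign: `d 0 > 0` would make `k * d` grow at rate at least
`c k(t)` near `0`, which is unbounded, whereas its slope is bounded there. -/
theorem apply_zero_nonpos (hk : IsSingularKernel k) (hd : Continuous d)
    (hB : ∀ s, |d s| ≤ B) (hg : Continuous g) (hL : 0 ≤ L) (hgd : ∀ s, g s ≤ L * |d s|)
    (hM : 0 < M)
    (H : ∀ a b, a ≤ b → b < M →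
      memory k (causal d) b - memory k (causal d) a ≤ ∫ s in a..b, causal g s) :
    d 0 ≤ 0 := by
  by_contra hcon
  have hpos : 0 < d 0 := not_le.1 hcon
  set c := d 0 / 2 with hc
  have hc0 : 0 < c := by positivity
  obtain ⟨ρ, hρ, hdρ⟩ := Metric.eventually_nhds_iff.1
    (hd.continuousAt.eventually (lt_mem_nhds (show c < d 0 by linarith)))
  obtain ⟨τ, hτ, hkτ⟩ := hk.unbounded (L * B / c + 1)
  obtain ⟨b, hb0, hb⟩ := exists_between (show 0 < min ρ (min τ M) by simp [hρ, hτ, hM])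
  rw [lt_min_iff, lt_min_iff] at hb
  have h1 := H 0 b hb0.le hb.2.2
  have hz : memory k (causal d) 0 = 0 := memory_causal_of_nonpos hk.eq_zero_of_neg d le_rfl
  have h2 : ∫ s in (0 : ℝ)..b, causal g s ≤ L * B * b := by
    have := intervalIntegral.integral_mono_on (f := causal g) (g := fun _ => L * B) hb0.le
      (intervalIntegrable_causal hg 0 b) (intervalIntegrable_const (μ := volume))
      (fun s hs => (causal_le_mul_abs hgd s).trans
        (mul_le_mul_of_nonneg_left (abs_causal_le hB s) hL))
    rw [intervalIntegral.integral_const, smul_eq_mul] at this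
    linarith
  have h3 : c * (k τ * b) ≤ memory k (causal d) b := by
    have h4 := hk.mul_le_integral (a := 0) (b := b) (τ := τ) le_rfl hb0.le hb.2.1.le
    rw [sub_zero] at h4
    refine (mul_le_mul_of_nonneg_left h4 hc0.le).trans ?_
    have := memory_indicator_Ici_sub hk.integrable 0 0 b
    rw [sub_zero, sub_zero] at this
    have hz' : memory k ((Ici 0).indicator fun _ => (1 : ℝ)) 0 = 0 :=
      memory_causal_of_nonpos hk.eq_zero_of_neg (fun _ => 1) le_rfl
    rw [hz', sub_zero] at this
    rw [← this, memory, memory, ← integral_const_mul]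
    refine integral_mono_ae ?_ (integrable_memory hk.integrable (measurable_causal hd)
      (abs_causal_le hB) b) ?_
    · refine (integrable_memory (B := 1) hk.integrable
        (measurable_const.indicator measurableSet_Ici) (fun s => ?_) b).const_mul c
      by_cases hs : 0 ≤ s <;> simp [hs]
    · refine Filter.Eventually.of_forall fun s => ?_
      simp only
      rw [mul_left_comm]
      rcases lt_trichotomy s 0 with hs | hs | hs
      · simp [hk.eq_zero_of_neg s hs]
      · refine mul_le_mul_of_nonneg_left ?_ (hk.nonneg s)
        subst hs
        have := hdρ (y := b) (by rw [Real.dist_eq, sub_zero, abs_of_pos hb0]; exact hb.1)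
        simpa [causal, hb0.le] using this.le
      · refine mul_le_mul_of_nonneg_left ?_ (hk.nonneg s)
        by_cases hs1 : s ≤ b
        · have := hdρ (y := b - s) (by
            rw [Real.dist_eq, sub_zero, abs_of_nonneg (by linarith)]; linarith [hb.1])
          simpa [causal, hs1] using this.le
        · simp [causal, hs1]
  rw [hz, sub_zero] at h1
  have h5 : c * (L * B / c + 1) * b ≤ L * B * b := by
    have := mul_le_mul_of_nonneg_right hkτ hb0.le
    have := mul_le_mul_of_nonneg_left this hc0.le
    linarith
  have h6 : c * (L * B / c + 1) = L * B + c := by field_simp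
  rw [h6] at h5
  nlinarith

/-- The comparison principle in linearized form: if `(k * causal d)' ≤ g` in integrated form and
`g ≤ L |d|`, then `d ≤ 0`. No sign of `d` enters the bound on `g`, as the inequality is used
only where `d` is close to a positive level. -/
theorem nonpos_of_memory_sub_le (hk : IsSingularKernel k) (hd : Continuous d)
    (hB : ∀ s, |d s| ≤ B) (hg : Continuous g) (hL : 0 ≤ L) (hgd : ∀ s, g s ≤ L * |d s|)
    (H : ∀ a b, a ≤ b → b < M →
      memory k (causal d) b - memory k (causal d) a ≤ ∫ s in a..b, causal g s)
    {t : ℝ} (ht : 0 ≤ t) (htM : t < M) : d t ≤ 0 := by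
  by_contra hcon
  have h0 := apply_zero_nonpos hk hd hB hg hL hgd (ht.trans_lt htM) H
  set A := {s | s ∈ Icc 0 t ∧ 0 < d s} with hA
  have hAne : A.Nonempty := ⟨t, ⟨ht, le_rfl⟩, not_le.1 hcon⟩
  have hAb : BddBelow A := ⟨0, fun s hs => hs.1.1⟩
  -- `τ₀` is the time up to which `d ≤ 0`; there `d` vanishes.
  set τ₀ := sInf A with hτ
  have hτ₀ : 0 ≤ τ₀ := le_csInf hAne fun s hs => hs.1.1
  have hτt : τ₀ ≤ t := csInf_le hAb ⟨⟨ht, le_rfl⟩, not_le.1 hcon⟩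
  have hlt : ∀ s, 0 ≤ s → s < τ₀ → d s ≤ 0 := fun s hs hs1 => by
    by_contra hn
    exact absurd (csInf_le hAb ⟨⟨hs, hs1.le.trans hτt⟩, not_le.1 hn⟩) (not_le.2 hs1)
  have hge : 0 ≤ d τ₀ := by
    have : closure A ⊆ {s | 0 ≤ d s} :=
      closure_minimal (fun s hs => hs.2.le) (isClosed_le continuous_const hd)
    exact this (csInf_mem_closure hAne hAb)
  have hle : d τ₀ ≤ 0 := by
    rcases hτ₀.eq_or_lt with h | h
    · rwa [← h]
    · refine le_of_tendsto (hd.continuousWithinAt (s := Iio τ₀) (x := τ₀)) ?_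
      filter_upwards [Ioo_mem_nhdsLT h] with s hs using hlt s hs.1.le hs.2
  obtain ⟨τ, hτpos, hext⟩ := exists_nonpos_extension hk hd hB hg hL hgd H hτ₀
    (le_antisymm hle hge) (fun s hs hs1 => by
      rcases hs1.eq_or_lt with h | h
      · exact h ▸ hle
      · exact hlt s hs h)
  obtain ⟨s, hs, hs1⟩ := exists_lt_of_csInf_lt hAne (show sInf A < τ₀ + τ by linarith)
  exact absurd (hext s (csInf_le hAb hs) hs1.le (hs.1.2.trans_lt htM)) (not_le.2 hs.2)

end Comparison

/-! ### From distributional to integrated inequalities -/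

theorem exists_abs_integral_bump_sub_le {P : ℝ → ℝ} (hP : Continuous P) (a : ℝ) {ε : ℝ}
    (hε : 0 < ε) : ∃ r > 0, ∀ ρ : ContDiffBump (0 : ℝ), ρ.rOut ≤ r →
      |(∫ y, ρ.normed volume (y - a) * P y) - P a| ≤ ε := by
  obtain ⟨r, hr, h⟩ := Metric.continuousAt_iff.1 (hP.continuousAt (x := a)) ε hε
  refine ⟨r, hr, fun ρ hρ => ?_⟩
  rw [← integral_add_right_eq_self _ a]
  simp only [add_sub_cancel_right]
  have hi : ∀ p : ℝ → ℝ, Continuous p → Integrable fun y => ρ.normed volume y * p y :=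
    fun p hp => (ρ.continuous_normed.mul hp).integrable_of_hasCompactSupport
      ρ.hasCompactSupport_normed.mul_right
  have h1 : ∫ y, ρ.normed volume y * P a = P a := by
    rw [integral_mul_const, ρ.integral_normed, one_mul]
  have h2 : ∫ y, ρ.normed volume y * ε = ε := by
    rw [integral_mul_const, ρ.integral_normed, one_mul]
  rw [← h1, ← integral_sub (hi _ (by fun_prop)) (hi _ continuous_const), ← h2,
    ← Real.norm_eq_abs]
  refine norm_integral_le_of_norm_le (hi _ continuous_const)
    (Filter.Eventually.of_forall fun y => ?_)
  rw [← mul_sub, norm_mul, Real.norm_of_nonneg (ρ.nonneg_normed y)]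
  by_cases hy : y ∈ Function.support (ρ.normed volume)
  · rw [ρ.support_normed_eq, Metric.mem_ball, dist_zero_right] at hy
    refine mul_le_mul_of_nonneg_left ?_ (ρ.nonneg_normed y)
    rw [← dist_eq_norm]
    exact (h (by rw [Real.dist_eq, add_sub_cancel_right]; exact hy.trans_le hρ)).le
  · rw [Function.notMem_support.1 hy]; simp

/-- The mollified indicator function of `[a, b]`, a nonnegative test function whose derivative is
the difference of two bumps, centred at `a` and at `b`. -/
theorem exists_test_function {a b r M : ℝ} (hab : a < b) (hr : r < a) (hb : b + r < M)
    (ρ : ContDiffBump (0 : ℝ)) (hρ : ρ.rOut ≤ r) :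
    ∃ φ : ℝ → ℝ, ContDiff ℝ (⊤ : ℕ∞) φ ∧ HasCompactSupport φ ∧ tsupport φ ⊆ Ioo 0 M ∧
      (∀ x, 0 ≤ φ x) ∧
      ∀ x, deriv φ x = ρ.normed volume (x - a) - ρ.normed volume (x - b) := by
  have hc : Continuous (ρ.normed volume) := ρ.continuous_normed
  set R : ℝ → ℝ := fun x => ∫ y in (0 : ℝ)..x, ρ.normed volume y with hR
  have hRd : ∀ x, HasDerivAt R (ρ.normed volume x) x := fun x =>
    intervalIntegral.integral_hasDerivAt_right (hc.intervalIntegrable _ _)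
      (hc.stronglyMeasurableAtFilter _ _) hc.continuousAt
  have hRs : ContDiff ℝ (⊤ : ℕ∞) R := by
    refine contDiff_infty_iff_deriv.2 ⟨fun x => (hRd x).differentiableAt, ?_⟩
    rw [show deriv R = ρ.normed volume from funext fun x => (hRd x).deriv]
    exact ρ.contDiff_normed
  have hRsub : ∀ x y, R y - R x = ∫ s in x..y, ρ.normed volume s := fun x y =>
    intervalIntegral.integral_interval_sub_left (hc.intervalIntegrable _ _)
      (hc.intervalIntegrable _ _)
  have hzero : ∀ s, r ≤ |s| → ρ.normed volume s = 0 := fun s hs => by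
    rw [← Function.notMem_support, ρ.support_normed_eq, Metric.mem_ball, dist_zero_right]
    exact not_lt.2 (hρ.trans hs)
  have hsupp : ∀ x, x ∉ Icc (a - r) (b + r) → R (x - a) - R (x - b) = 0 := fun x hx => by
    rw [hRsub]
    refine intervalIntegral.integral_zero_ae (Filter.Eventually.of_forall fun s hs => ?_)
    rw [uIoc_of_le (by linarith)] at hs
    refine hzero s ?_
    by_cases h1 : x < a - r
    · exact le_abs.2 (Or.inr (by linarith [hs.2]))
    · have : b + r < x := by
        by_contra h2
        exact hx ⟨not_lt.1 h1, not_lt.1 h2⟩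
      exact le_abs.2 (Or.inl (by linarith [hs.1]))
  refine ⟨fun x => R (x - a) - R (x - b), ?_, ?_, ?_, fun x => ?_, fun x => ?_⟩
  · exact (hRs.comp (contDiff_id.sub contDiff_const)).sub
      (hRs.comp (contDiff_id.sub contDiff_const))
  · exact HasCompactSupport.intro isCompact_Icc hsupp
  · refine (closure_minimal (fun x hx => ?_) isClosed_Icc : _ ⊆ Icc (a - r) (b + r)).trans
      (Icc_subset_Ioo (by linarith) hb)
    by_contra h
    exact hx (hsupp x h)
  · simp only [hRsub]
    exact intervalIntegral.integral_nonneg (by linarith) fun s _ => ρ.nonneg_normed s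
  · exact (((hRd _).comp_sub_const x a).sub ((hRd _).comp_sub_const x b)).deriv

/-- If `P' ≤ Q` in the distributional sense on `(0, M)`, then the integrated inequality holds
there: `P - ∫ Q` has nonpositive distributional derivative, and testing it with mollified indicator
functions of `[a, b]` compares its values at `a` and `b`. -/
theorem sub_le_integral_of_weak {P Q : ℝ → ℝ} {M : ℝ} (hP : Continuous P) (hQ : Continuous Q)
    (h : ∀ φ : ℝ → ℝ, ContDiff ℝ (⊤ : ℕ∞) φ → HasCompactSupport φ → tsupport φ ⊆ Ioo 0 M →
      (∀ x, 0 ≤ φ x) → -∫ x, deriv φ x * P x ≤ ∫ x, φ x * Q x)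
    {a b : ℝ} (ha : 0 < a) (hab : a < b) (hb : b < M) : P b - P a ≤ ∫ x in a..b, Q x := by
  set F : ℝ → ℝ := fun x => ∫ s in (0 : ℝ)..x, Q s with hF
  have hFd : ∀ x, HasDerivAt F (Q x) x := fun x =>
    intervalIntegral.integral_hasDerivAt_right (hQ.intervalIntegrable _ _)
      (hQ.stronglyMeasurableAtFilter _ _) hQ.continuousAt
  have hFc : Continuous F := continuous_iff_continuousAt.2 fun x => (hFd x).continuousAt
  have hFab : F b - F a = ∫ s in a..b, Q s :=
    intervalIntegral.integral_interval_sub_left (hQ.intervalIntegrable _ _)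
      (hQ.intervalIntegrable _ _)
  rw [← hFab]
  suffices P b - F b ≤ P a - F a by linarith
  have hPF : Continuous fun x => P x - F x := hP.sub hFc
  refine le_of_forall_pos_le_add fun ε hε => ?_
  obtain ⟨r₁, hr₁, h₁⟩ := exists_abs_integral_bump_sub_le hPF a (half_pos hε)
  obtain ⟨r₂, hr₂, h₂⟩ := exists_abs_integral_bump_sub_le hPF b (half_pos hε)
  obtain ⟨r, hr0, hr⟩ := exists_between (show 0 < min (min r₁ r₂) (min a (M - b)) by
    simp [hr₁, hr₂, ha, hb])
  simp only [lt_min_iff] at hr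
  obtain ⟨⟨hrr₁, hrr₂⟩, hra, hrb⟩ := hr
  let ρ : ContDiffBump (0 : ℝ) := ⟨r / 2, r, by linarith, by linarith⟩
  obtain ⟨φ, hφs, hφc, hφt, hφ0, hφd⟩ :=
    exists_test_function (M := M) hab hra (by linarith) ρ le_rfl
  have hφ' : Continuous (deriv φ) := hφs.continuous_deriv (by simp)
  have hcs : ∀ p : ℝ → ℝ, Continuous p → Integrable fun x => deriv φ x * p x := fun p hp =>
    (hφ'.mul hp).integrable_of_hasCompactSupport hφc.deriv.mul_right
  have hcs' : ∀ p : ℝ → ℝ, Continuous p → Integrable fun x => φ x * p x := fun p hp =>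
    (hφs.continuous.mul hp).integrable_of_hasCompactSupport hφc.mul_right
  have hparts : ∫ x, φ x * Q x = -∫ x, deriv φ x * F x :=
    integral_mul_deriv_eq_deriv_mul_of_integrable
      (fun x _ => (hφs.differentiable (by simp) x).hasDerivAt) (fun x _ => hFd x)
      (hcs' _ hQ) (hcs _ hFc) (hcs' _ hFc)
  have hmain := h φ hφs hφc hφt hφ0
  rw [hparts] at hmain
  have e : ∫ x, deriv φ x * (P x - F x) =
      (∫ y, ρ.normed volume (y - a) * (P y - F y)) -
        ∫ y, ρ.normed volume (y - b) * (P y - F y) := by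
    have hi : ∀ c, Integrable fun y => ρ.normed volume (y - c) * (P y - F y) := fun c =>
      ((ρ.continuous_normed.comp (continuous_id.sub continuous_const)).mul
        hPF).integrable_of_hasCompactSupport
        ((ρ.hasCompactSupport_normed.comp_homeomorph (Homeomorph.subRight c)).mul_right)
    rw [← integral_sub (hi a) (hi b)]
    congr 1; ext x; rw [hφd]; ring
  have e2 : ∫ x, deriv φ x * (P x - F x) =
      (∫ x, deriv φ x * P x) - ∫ x, deriv φ x * F x := by
    rw [← integral_sub (hcs _ hP) (hcs _ hFc)]
    congr 1; ext x; ring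
  have h3 := abs_le.1 (h₁ ρ hrr₁.le)
  have h4 := abs_le.1 (h₂ ρ hrr₂.le)
  linarith [h3.1, h3.2, h4.1, h4.2]

/-- Since `P` is continuous and vanishes before time `0`, its distributional derivative has no atom
at `0`, so an inequality tested only on `(0, M)` extends to all of `(-∞, M)`. -/
theorem sub_le_integral_causal_of_weak {P Q : ℝ → ℝ} {M : ℝ} (hP : Continuous P)
    (hP0 : ∀ x ≤ 0, P x = 0) (hQ : Continuous Q)
    (h : ∀ φ : ℝ → ℝ, ContDiff ℝ (⊤ : ℕ∞) φ → HasCompactSupport φ → tsupport φ ⊆ Ioo 0 M →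
      (∀ x, 0 ≤ φ x) → -∫ x, deriv φ x * P x ≤ ∫ x, φ x * Q x)
    {a b : ℝ} (hab : a ≤ b) (hb : b < M) : P b - P a ≤ ∫ x in a..b, causal Q x := by
  have hQi := intervalIntegrable_causal hQ
  have hneg : ∀ x y, x ≤ y → y ≤ 0 → ∫ s in x..y, causal Q s = 0 := fun x y hxy hy => by
    refine intervalIntegral.integral_zero_ae ?_
    filter_upwards [(measure_eq_zero_iff_ae_notMem.1 (measure_singleton (μ := volume) (0 : ℝ)))]
      with s hs hs1
    rw [uIoc_of_le hxy] at hs1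
    have : s < 0 := lt_of_le_of_ne (hs1.2.trans hy) hs
    simp [causal, this]
  have hpos : ∀ x y, 0 ≤ x → x ≤ y → ∫ s in x..y, causal Q s = ∫ s in x..y, Q s :=
    fun x y hx hxy => intervalIntegral.integral_congr fun s hs => by
      rw [uIcc_of_le hxy] at hs
      simp [causal, hx.trans hs.1]
  rcases le_or_gt b 0 with hb0 | hb0
  · rw [hP0 b hb0, hP0 a (hab.trans hb0), hneg a b hab hb0, sub_zero]
  have hz : P b - P 0 ≤ ∫ x in (0 : ℝ)..b, Q x := by
    have hFc : Continuous fun x => ∫ s in x..b, Q s := by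
      simp only [intervalIntegral.integral_symm b]
      exact (intervalIntegral.continuous_primitive (fun x y => hQ.intervalIntegrable x y) b).neg
    refine le_of_tendsto_of_tendsto (b := nhdsWithin 0 (Ioi 0)) (f := fun x => P b - P x)
      (g := fun x => ∫ s in x..b, Q s)
      (continuous_const.sub hP).continuousWithinAt hFc.continuousWithinAt ?_
    filter_upwards [Ioo_mem_nhdsGT hb0] with x hx
    exact sub_le_integral_of_weak hP hQ h hx.1 hx.2 hb
  rcases le_or_gt a 0 with ha0 | ha0
  · rw [← intervalIntegral.integral_add_adjacent_intervals (hQi a 0) (hQi 0 b),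
      hneg a 0 ha0 le_rfl, hpos 0 b le_rfl hb0.le, zero_add, hP0 a ha0]
    rwa [hP0 0 le_rfl] at hz
  · rw [hpos a b ha0.le hab]
    rcases hab.eq_or_lt with h1 | h1
    · simp [h1]
    · exact sub_le_integral_of_weak hP hQ h ha0 h1 hb

/-! ### The Caputo derivative before a time `M` -/

/-- The kernel `t ^ (-γ)` restricted to `[0, M]`, which makes it integrable. At `t = 0` its value
is `0` (for `γ ≠ 0`), by the convention for real powers of `0`. -/
noncomputable def truncKernel (γ M : ℝ) : ℝ → ℝ := (Icc 0 M).indicator fun t => t ^ (-γ)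

theorem isSingularKernel_truncKernel {γ M : ℝ} (hγ₀ : 0 < γ) (hγ₁ : γ < 1) (hM : 0 < M) :
    IsSingularKernel (truncKernel γ M) where
  integrable := integrable_kernel hγ₁ M
  nonneg s := indicator_nonneg (fun t ht => Real.rpow_nonneg ht.1 _) s
  eq_zero_of_neg s hs := indicator_of_notMem (fun h => absurd h.1 (not_le.2 hs)) _
  antitoneOn := fun x (hx : 0 < x) y (hy : 0 < y) hxy => by
    by_cases hyM : y ≤ M
    · simp only [truncKernel, indicator_apply, mem_Icc, hx.le, hy.le, hyM, hxy.trans hyM,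
        and_self, if_true]
      exact Real.rpow_le_rpow_of_nonpos hx hxy (by linarith)
    · rw [truncKernel, indicator_of_notMem (fun h => hyM h.2)]
      exact indicator_nonneg (fun t ht => Real.rpow_nonneg ht.1 _) x
  unbounded C := by
    have := (tendsto_rpow_neg_nhdsGT_zero (neg_lt_zero.2 hγ₀)).eventually_ge_atTop C
    obtain ⟨τ, h1, h2⟩ := (this.and (Ioo_mem_nhdsGT hM)).exists
    refine ⟨τ, h2.1, ?_⟩
    rwa [truncKernel, indicator_of_mem (show τ ∈ Icc 0 M from ⟨h2.1.le, h2.2.le⟩)]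
  small ε hε := by
    have hc : ContinuousAt (fun r : ℝ => r ^ (1 - γ)) 0 :=
      Real.continuousAt_rpow_const _ _ (Or.inr (by linarith))
    obtain ⟨ρ, hρ, h⟩ := Metric.continuousAt_iff.1 hc ε hε
    refine ⟨ρ, hρ, fun r hr hrρ => ?_⟩
    have h1 := h (x := r) (by rwa [Real.dist_eq, sub_zero, abs_of_pos hr])
    rw [Real.zero_rpow (by linarith), Real.dist_eq, sub_zero, sub_eq_add_neg,
      Real.rpow_add hr, Real.rpow_one] at h1
    refine le_trans ?_ ((le_abs_self _).trans h1.le)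
    refine mul_le_mul_of_nonneg_left ?_ hr.le
    exact indicator_le_self' (fun _ _ => Real.rpow_nonneg hr.le _) r

/-- The projection of `t` to `[0, M]`. Composing with it extends a function on `[0, M]` to a
bounded continuous function on `ℝ`. -/
def clamp (M t : ℝ) : ℝ := max 0 (min t M)

theorem continuous_clamp (M : ℝ) : Continuous (clamp M) := by unfold clamp; fun_prop

theorem clamp_mem {M : ℝ} (hM : 0 ≤ M) (t : ℝ) : clamp M t ∈ Icc 0 M :=
  ⟨le_max_left _ _, max_le hM (min_le_right _ _)⟩

theorem clamp_eq {M t : ℝ} (ht : t ∈ Icc 0 M) : clamp M t = t := by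
  rw [clamp, min_eq_left ht.2, max_eq_right ht.1]

theorem continuous_comp_clamp {M : ℝ} (hM : 0 ≤ M) {w : ℝ → ℝ} (hw : ContinuousOn w (Icc 0 M)) :
    Continuous fun t => w (clamp M t) :=
  hw.comp_continuous (continuous_clamp M) (clamp_mem hM)

theorem exists_bound_comp_clamp {M : ℝ} (hM : 0 ≤ M) {w : ℝ → ℝ}
    (hw : ContinuousOn w (Icc 0 M)) : ∃ B, ∀ t, |w (clamp M t)| ≤ B := by
  obtain ⟨B, hB⟩ := isCompact_Icc.exists_bound_of_continuousOn hw
  exact ⟨B, fun t => hB _ (clamp_mem hM t)⟩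

theorem Icc_subset_timeInterval {T : EReal} {M : ℝ} (hMT : (M : EReal) < T) :
    Icc 0 M ⊆ timeInterval T :=
  fun _ ht => ⟨ht.1, (EReal.coe_le_coe_iff.2 ht.2).trans_lt hMT⟩

theorem convolution_eq_memory {γ M x : ℝ} (w : ℝ → ℝ) (w₀ : ℝ) (hx : x ≤ M) :
    ((causal fun t => t ^ (-γ)) ⋆[ContinuousLinearMap.mul ℝ ℝ, volume]
      (causal fun t => w t - w₀)) x =
      memory (truncKernel γ M) (causal fun t => w (clamp M t) - w₀) x := by
  rw [convolution_def, memory]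
  congr 1; ext s
  simp only [causal, truncKernel, ContinuousLinearMap.mul_apply', indicator_apply, mem_Ici,
    mem_Icc]
  by_cases h1 : 0 ≤ s <;> by_cases h2 : 0 ≤ x - s
  · have h3 : s ≤ M := by linarith
    rw [clamp_eq ⟨h2, by linarith⟩]
    simp [h1, h2, h3]
  · simp [h2]
  · simp [h1]
  · simp [h1]

theorem locallyIntegrableOn_causal {T : EReal} {q : ℝ → ℝ}
    (hq : LocallyIntegrableOn q (timeInterval T)) :
    LocallyIntegrableOn (causal q) (below T : Set ℝ) := by
  intro x hx
  obtain ⟨M, hxM, hM⟩ := EReal.lt_iff_exists_real_btwn.1 (show (x : EReal) < T from hx)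
  have hxM' : x < M := EReal.coe_lt_coe_iff.1 hxM
  refine ⟨Iic M, mem_nhdsWithin_of_mem_nhds (Iic_mem_nhds hxM'), ?_⟩
  have h := integrable_truncated hq 0 hM
  refine h.integrableOn.congr_fun (fun y hy => ?_) measurableSet_Iic
  have hy' : y ≤ M := hy
  simp [causal, indicator_apply, hy']

theorem caputoDeriv_apply_eq_integral {γ : ℝ} (hγ₁ : γ < 1) {T : EReal} {w : ℝ → ℝ}
    (hw : LocallyIntegrableOn w (timeInterval T)) (w₀ : ℝ) {M : ℝ}
    (φ : 𝓓(below T, ℝ)) (hφ : tsupport φ ⊆ Ioo 0 M) :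
    caputoDeriv γ T w w₀ φ = -∫ x, deriv φ x * ((Real.Gamma (1 - γ))⁻¹ *
      memory (truncKernel γ M) (causal fun t => w (clamp M t) - w₀) x) := by
  have hφ1 : ContDiff ℝ 1 φ := φ.contDiff.of_le (by exact_mod_cast le_top)
  have : caputoDeriv γ T w w₀ φ = (Real.Gamma (1 - γ))⁻¹ *
      (∂_{(1 : ℝ)} (ofFun (below T) ((causal fun t => t ^ (-γ))
        ⋆[ContinuousLinearMap.mul ℝ ℝ, volume] (causal fun t => w t - w₀))) φ) := rfl
  rw [this, Distribution.lineDerivOp_apply_apply, map_neg, mul_neg]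
  refine congrArg Neg.neg ?_
  simp only [mul_left_comm (deriv φ _)]
  rw [integral_const_mul]
  refine congrArg _ ((TestFunction.integralAgainstBilinCLM_eq_integral
    (locallyIntegrableOn_convolution hγ₁ hw w₀)).trans ?_)
  refine integral_congr_ae (Filter.Eventually.of_forall fun x => ?_)
  have hx : (∂_{(1 : ℝ)} φ) x = deriv φ x := by
    rw [TestFunction.lineDerivOp_eq_lineDerivCLM ℝ, TestFunction.lineDerivCLM_apply_of_le le_top,
      (hφ1.differentiable one_ne_zero x).lineDeriv_eq_fderiv]
    rfl
  simp only [ContinuousLinearMap.mul_apply', hx]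
  rcases le_or_gt x M with h | h
  · rw [convolution_eq_memory _ _ h]
  · rw [show deriv φ x = 0 from by_contra fun h' =>
      absurd (hφ (support_deriv_subset h')).2 h.not_gt]
    simp

theorem ofFun_causal_apply {T : EReal} {q : ℝ → ℝ}
    (hq : LocallyIntegrableOn q (timeInterval T)) {M : ℝ}
    (φ : 𝓓(below T, ℝ)) (hφ : tsupport φ ⊆ Ioo 0 M) :
    ofFun (below T) (causal q) φ = ∫ x, φ x * q (clamp M x) := by
  refine (TestFunction.integralAgainstBilinCLM_eq_integral
    (locallyIntegrableOn_causal hq)).trans ?_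
  refine integral_congr_ae (Filter.Eventually.of_forall fun x => ?_)
  simp only [ContinuousLinearMap.mul_apply']
  by_cases hx : x ∈ tsupport φ
  · have := hφ hx
    rw [clamp_eq (Ioo_subset_Icc_self this)]
    simp [causal, this.1.le]
  · simp [image_eq_zero_of_notMem_tsupport hx]

theorem locallyIntegrableOn_timeInterval {T : EReal} {w : ℝ → ℝ}
    (hw : ContinuousOn w (timeInterval T)) : LocallyIntegrableOn w (timeInterval T) :=
  hw.locallyIntegrableOn (measurableSet_Ici.inter (below T).isOpen.measurableSet)

section Volterra

variable {γ : ℝ} {T : EReal} {w q : ℝ → ℝ} {w₀ M a b : ℝ}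

theorem continuous_memory_clamp (hγ₁ : γ < 1) (hM : 0 ≤ M) (hMT : (M : EReal) < T)
    (hw : ContinuousOn w (timeInterval T)) (w₀ : ℝ) :
    Continuous (memory (truncKernel γ M) (causal fun t => w (clamp M t) - w₀)) := by
  have hwM : ContinuousOn (fun t => w t - w₀) (Icc 0 M) :=
    (hw.mono (Icc_subset_timeInterval hMT)).sub continuousOn_const
  obtain ⟨B, hB⟩ := exists_bound_comp_clamp hM hwM
  exact continuous_memory_causal (integrable_kernel hγ₁ M) (continuous_comp_clamp hM hwM) hB

theorem memory_truncKernel_of_nonpos (d : ℝ → ℝ) {x : ℝ} (hx : x ≤ 0) :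
    memory (truncKernel γ M) (causal d) x = 0 :=
  memory_causal_of_nonpos (fun _ hs => indicator_of_notMem (fun h => absurd h.1 (not_le.2 hs)) _)
    d hx

theorem memory_sub_le_of_distLE (hγ₁ : γ < 1) (hM : 0 ≤ M) (hMT : (M : EReal) < T)
    (hw : ContinuousOn w (timeInterval T)) (hq : ContinuousOn q (timeInterval T))
    (h : DistLE (caputoDeriv γ T w w₀) (ofFun (below T) (causal q))) (hab : a ≤ b) (hb : b < M) :
    memory (truncKernel γ M) (causal fun t => w (clamp M t) - w₀) b -
      memory (truncKernel γ M) (causal fun t => w (clamp M t) - w₀) a ≤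
      Real.Gamma (1 - γ) * ∫ s in a..b, causal (fun t => q (clamp M t)) s := by
  have hΓ : 0 < Real.Gamma (1 - γ) := Real.Gamma_pos_of_pos (by linarith)
  have := sub_le_integral_causal_of_weak (a := a) (b := b) (M := M)
    (P := fun x => (Real.Gamma (1 - γ))⁻¹ *
      memory (truncKernel γ M) (causal fun t => w (clamp M t) - w₀) x)
    (continuous_const.mul (continuous_memory_clamp hγ₁ hM hMT hw w₀))
    (fun x hx => by rw [memory_truncKernel_of_nonpos _ hx, mul_zero])
    (continuous_comp_clamp hM (hq.mono (Icc_subset_timeInterval hMT)))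
    (fun φ hφ hφc hφt hφ0 => ?_) hab hb
  · rwa [← mul_sub, inv_mul_le_iff₀ hΓ] at this
  · have hφ := h ⟨φ, hφ, hφc, fun x hx =>
      (EReal.coe_lt_coe_iff.2 (hφt hx).2).trans hMT⟩ hφ0 (hφt.trans Ioo_subset_Ioi_self)
    rwa [caputoDeriv_apply_eq_integral hγ₁ (locallyIntegrableOn_timeInterval hw) w₀ _ hφt,
      ofFun_causal_apply (locallyIntegrableOn_timeInterval hq) _ hφt] at hφ

theorem le_memory_sub_of_distLE (hγ₁ : γ < 1) (hM : 0 ≤ M) (hMT : (M : EReal) < T)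
    (hw : ContinuousOn w (timeInterval T)) (hq : ContinuousOn q (timeInterval T))
    (h : DistLE (ofFun (below T) (causal q)) (caputoDeriv γ T w w₀)) (hab : a ≤ b) (hb : b < M) :
    Real.Gamma (1 - γ) * ∫ s in a..b, causal (fun t => q (clamp M t)) s ≤
      memory (truncKernel γ M) (causal fun t => w (clamp M t) - w₀) b -
      memory (truncKernel γ M) (causal fun t => w (clamp M t) - w₀) a := by
  have hΓ : 0 < Real.Gamma (1 - γ) := Real.Gamma_pos_of_pos (by linarith)
  have := sub_le_integral_causal_of_weak (a := a) (b := b) (M := M)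
    (P := fun x => -((Real.Gamma (1 - γ))⁻¹ *
      memory (truncKernel γ M) (causal fun t => w (clamp M t) - w₀) x))
    (Q := fun t => -q (clamp M t))
    (continuous_const.mul (continuous_memory_clamp hγ₁ hM hMT hw w₀)).neg
    (fun x hx => by rw [memory_truncKernel_of_nonpos _ hx, mul_zero, neg_zero])
    (continuous_comp_clamp hM (hq.mono (Icc_subset_timeInterval hMT))).neg
    (fun φ hφ hφc hφt hφ0 => ?_) hab hb
  · have e : causal (fun t => -q (clamp M t)) = fun s => -causal (fun t => q (clamp M t)) s :=
      indicator_neg _ _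
    rw [e, intervalIntegral.integral_neg] at this
    rw [← le_inv_mul_iff₀ hΓ, mul_sub]
    linarith
  · have hφ := h ⟨φ, hφ, hφc, fun x hx =>
      (EReal.coe_lt_coe_iff.2 (hφt hx).2).trans hMT⟩ hφ0 (hφt.trans Ioo_subset_Ioi_self)
    rw [caputoDeriv_apply_eq_integral hγ₁ (locallyIntegrableOn_timeInterval hw) w₀ _ hφt,
      ofFun_causal_apply (locallyIntegrableOn_timeInterval hq) _ hφt] at hφ
    simp only [mul_neg, integral_neg]
    exact neg_le_neg hφ

end Volterra

/-! ### Comparison of subsolutions and supersolutions -/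

theorem memory_causal_sub {k v w : ℝ → ℝ} {Bv Bw : ℝ} (hk : Integrable k) (hv : Continuous v)
    (hw : Continuous w) (hvB : ∀ t, |v t| ≤ Bv) (hwB : ∀ t, |w t| ≤ Bw) (v₀ w₀ x : ℝ) :
    memory k (causal fun t => v t - w t) x =
      memory k (causal fun t => v t - v₀) x - memory k (causal fun t => w t - w₀) x +
        (v₀ - w₀) * memory k (causal fun _ => 1) x := by
  have hi : ∀ (p : ℝ → ℝ) (B c : ℝ), Continuous p → (∀ t, |p t| ≤ B) →
      Integrable fun s => k s * causal (fun t => p t - c) (x - s) := fun p B c hp hB =>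
    integrable_memory (B := B + |c|) hk (measurable_causal (hp.sub continuous_const))
      (abs_causal_le fun t => (abs_sub _ _).trans (add_le_add_left (hB t) _)) x
  have h1 : Integrable fun s => k s * causal (fun _ => 1) (x - s) :=
    integrable_memory (B := 1) hk (measurable_causal continuous_const)
      (abs_causal_le fun t => by simp) x
  have h2 : Integrable fun s => k s * causal (fun t => v t - v₀) (x - s) -
      k s * causal (fun t => w t - w₀) (x - s) := (hi v Bv v₀ hv hvB).sub (hi w Bw w₀ hw hwB)
  simp only [memory]
  rw [← integral_const_mul, ← integral_sub (hi v Bv v₀ hv hvB) (hi w Bw w₀ hw hwB),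
    ← integral_add h2 (h1.const_mul _)]
  congr 1; ext s
  by_cases hs : s ≤ x
  · simp [causal, hs]; ring
  · simp [causal, hs]

theorem continuousOn_comp_state {α β : EReal} {f : ℝ → ℝ → ℝ}
    (hf : ContinuousOn (fun p : ℝ × ℝ => f p.1 p.2) (Ici (0 : ℝ) ×ˢ stateInterval α β))
    {T : EReal} {w : ℝ → ℝ} (hw : ContinuousOn w (timeInterval T))
    (hw_mem : MapsTo w (timeInterval T) (stateInterval α β)) :
    ContinuousOn (fun t => f t (w t)) (timeInterval T) :=
  hf.comp (continuousOn_id.prodMk hw) fun _ ht => ⟨ht.1, hw_mem ht⟩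

/-- Over a bounded time interval the graphs of `v` and `w` are compact, so `f` is Lipschitz along
them. -/
theorem exists_lipschitz_along {α β : EReal} {f : ℝ → ℝ → ℝ}
    (hfL : LocallyLipschitzInState f α β) {M : ℝ} {v w : ℝ → ℝ}
    (hv : ContinuousOn v (Icc 0 M)) (hw : ContinuousOn w (Icc 0 M))
    (hv_mem : MapsTo v (Icc 0 M) (stateInterval α β))
    (hw_mem : MapsTo w (Icc 0 M) (stateInterval α β)) :
    ∃ L, 0 ≤ L ∧ ∀ t ∈ Icc 0 M, |f t (v t) - f t (w t)| ≤ L * |v t - w t| := by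
  obtain ⟨L, hL⟩ := hfL ((fun t => (t, v t)) '' Icc 0 M ∪ (fun t => (t, w t)) '' Icc 0 M)
    ((isCompact_Icc.image_of_continuousOn (continuousOn_id.prodMk hv)).union
      (isCompact_Icc.image_of_continuousOn (continuousOn_id.prodMk hw))) (by
      rintro _ (⟨t, ht, rfl⟩ | ⟨t, ht, rfl⟩)
      · exact ⟨ht.1, hv_mem ht⟩
      · exact ⟨ht.1, hw_mem ht⟩)
  exact ⟨max L 0, le_max_right _ _, fun t ht =>
    (hL t _ _ (Or.inl ⟨t, ht, rfl⟩) (Or.inr ⟨t, ht, rfl⟩)).trans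
      (mul_le_mul_of_nonneg_right (le_max_left _ _) (abs_nonneg _))⟩

/-- A weak subsolution lies below a weak supersolution. The difference `d = v - w` satisfies
`(k * d)' ≤ Γ(1 - γ) (f(t, v) - f(t, w)) ≤ Γ(1 - γ) L |d|`; the initial values contribute
`(v₀ - w₀) k ≤ 0`. -/
theorem le_of_subsolution_of_supersolution {γ : ℝ} (hγ₀ : 0 < γ) (hγ₁ : γ < 1) {α β : EReal}
    {f : ℝ → ℝ → ℝ}
    (hf : ContinuousOn (fun p : ℝ × ℝ => f p.1 p.2) (Ici (0 : ℝ) ×ˢ stateInterval α β))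
    (hfL : LocallyLipschitzInState f α β) {Tv Tw : EReal} {v w : ℝ → ℝ} {v₀ w₀ : ℝ}
    (hv : ContinuousOn v (timeInterval Tv))
    (hv_mem : MapsTo v (timeInterval Tv) (stateInterval α β))
    (hw : ContinuousOn w (timeInterval Tw))
    (hw_mem : MapsTo w (timeInterval Tw) (stateInterval α β)) (h₀ : v₀ ≤ w₀)
    (hv_sub : DistLE (caputoDeriv γ Tv v v₀) (rhs Tv f v))
    (hw_super : DistLE (rhs Tw f w) (caputoDeriv γ Tw w w₀))
    {t : ℝ} (ht : 0 ≤ t) (htv : (t : EReal) < Tv) (htw : (t : EReal) < Tw) : v t ≤ w t := by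
  obtain ⟨M, htM, hM⟩ := EReal.lt_iff_exists_real_btwn.1 (lt_min htv htw)
  replace htM : t < M := EReal.coe_lt_coe_iff.1 htM
  obtain ⟨hMv, hMw⟩ := lt_min_iff.1 hM
  have hM0 : 0 < M := ht.trans_lt htM
  have hIv := Icc_subset_timeInterval hMv
  have hIw := Icc_subset_timeInterval hMw
  obtain ⟨L, hL0, hL⟩ := exists_lipschitz_along hfL (hv.mono hIv) (hw.mono hIw)
    (hv_mem.mono_left hIv) (hw_mem.mono_left hIw)
  have hVc := continuous_comp_clamp hM0.le (hv.mono hIv)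
  have hWc := continuous_comp_clamp hM0.le (hw.mono hIw)
  have hfv := continuousOn_comp_state hf hv hv_mem
  have hfw := continuousOn_comp_state hf hw hw_mem
  have hFv := continuous_comp_clamp hM0.le (hfv.mono hIv)
  have hFw := continuous_comp_clamp hM0.le (hfw.mono hIw)
  obtain ⟨Bv, hBv⟩ := exists_bound_comp_clamp hM0.le (hv.mono hIv)
  obtain ⟨Bw, hBw⟩ := exists_bound_comp_clamp hM0.le (hw.mono hIw)
  have hΓ : 0 < Real.Gamma (1 - γ) := Real.Gamma_pos_of_pos (by linarith)
  have hk := isSingularKernel_truncKernel hγ₀ hγ₁ hM0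
  have key := nonpos_of_memory_sub_le (t := t) (M := M) (L := Real.Gamma (1 - γ) * L) hk
    (d := fun s => v (clamp M s) - w (clamp M s))
    (g := fun s => Real.Gamma (1 - γ) *
      (f (clamp M s) (v (clamp M s)) - f (clamp M s) (w (clamp M s))))
    (hVc.sub hWc) (fun s => (abs_sub _ _).trans (add_le_add (hBv s) (hBw s)))
    (continuous_const.mul (hFv.sub hFw)) (by positivity)
    (fun s => by
      rw [mul_assoc]
      exact mul_le_mul_of_nonneg_left ((le_abs_self _).trans (hL _ (clamp_mem hM0.le s))) hΓ.le)
    (fun a b hab hb => ?_) ht htM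
  · rw [clamp_eq ⟨ht, htM.le⟩] at key
    linarith
  have h1 := memory_sub_le_of_distLE hγ₁ hM0.le hMv hv hfv hv_sub hab hb
  have h2 := le_memory_sub_of_distLE hγ₁ hM0.le hMw hw hfw hw_super hab hb
  have h3 : 0 ≤ memory (truncKernel γ M) (causal fun _ => 1) b -
      memory (truncKernel γ M) (causal fun _ => 1) a := by
    have := memory_indicator_Ici_sub hk.integrable 0 a b
    rw [show causal (fun _ => (1 : ℝ)) = (Ici 0).indicator fun _ => (1 : ℝ) from rfl, this]
    exact intervalIntegral.integral_nonneg (by linarith) fun s _ => hk.nonneg s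
  have e : ∫ s in a..b, causal (fun s => Real.Gamma (1 - γ) *
      (f (clamp M s) (v (clamp M s)) - f (clamp M s) (w (clamp M s)))) s =
      Real.Gamma (1 - γ) * (∫ s in a..b, causal (fun s => f (clamp M s) (v (clamp M s))) s) -
      Real.Gamma (1 - γ) * ∫ s in a..b, causal (fun s => f (clamp M s) (w (clamp M s))) s := by
    rw [← mul_sub, ← intervalIntegral.integral_sub (intervalIntegrable_causal hFv a b)
        (intervalIntegrable_causal hFw a b),
      ← intervalIntegral.integral_const_mul]
    congr 1; ext s
    by_cases hs : 0 ≤ s <;> simp [causal, hs]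
  rw [e, memory_causal_sub hk.integrable hVc hWc hBv hBw v₀ w₀,
    memory_causal_sub hk.integrable hVc hWc hBv hBw v₀ w₀]
  have h4 := mul_nonneg (sub_nonneg.2 h₀) h3
  linarith

end TimeFractional

theorem mainTheorem2
    (γ : ℝ) (hγ₀ : 0 < γ) (hγ₁ : γ < 1)
    (α β : EReal) (f : ℝ → ℝ → ℝ)
    (hf : ContinuousOn (fun p : ℝ × ℝ => f p.1 p.2)
      (Set.Ici (0 : ℝ) ×ˢ TimeFractional.stateInterval α β))
    (hfL : TimeFractional.LocallyLipschitzInState f α β)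
    (Tu Tv : EReal) (hTu : 0 < Tu) (hTv : 0 < Tv)
    (u v : ℝ → ℝ) (u₀ v₀ : ℝ)
    (hu : ContinuousOn u (TimeFractional.timeInterval Tu))
    (hu_mem : Set.MapsTo u (TimeFractional.timeInterval Tu) (TimeFractional.stateInterval α β))
    (hu_sol : TimeFractional.IsWeakSolution γ Tu f u u₀)
    (hv : ContinuousOn v (TimeFractional.timeInterval Tv))
    (hv_mem : Set.MapsTo v (TimeFractional.timeInterval Tv)
      (TimeFractional.stateInterval α β)) :
    (v₀ ≤ u₀ →
      TimeFractional.DistLE (TimeFractional.caputoDeriv γ Tv v v₀)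
        (TimeFractional.rhs Tv f v) →
      ∀ t ∈ TimeFractional.timeInterval (min Tu Tv), v t ≤ u t) ∧
    (u₀ ≤ v₀ →
      TimeFractional.DistLE (TimeFractional.rhs Tv f v)
        (TimeFractional.caputoDeriv γ Tv v v₀) →
      ∀ t ∈ TimeFractional.timeInterval (min Tu Tv), u t ≤ v t) :=
  ⟨fun h₀ h _ ht => TimeFractional.le_of_subsolution_of_supersolution hγ₀ hγ₁ hf hfL
      hv hv_mem hu hu_mem h₀ h (fun φ _ _ => (congrArg (· φ) hu_sol.equation).ge)
      ht.1 (lt_min_iff.1 ht.2).2 (lt_min_iff.1 ht.2).1,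
    fun h₀ h _ ht => TimeFractional.le_of_subsolution_of_supersolution hγ₀ hγ₁ hf hfL
      hu hu_mem hv hv_mem h₀ (fun φ _ _ => (congrArg (· φ) hu_sol.equation).le) h
      ht.1 (lt_min_iff.1 ht.2).1 (lt_min_iff.1 ht.2).2⟩
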